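/- **Proposition (recurrence in a $1/4$-octahedron).** Let $\mathbb F$ be a semifield, i.e. a set with a commutative and associative addition and a multiplication which makes $\mathbb F$ an abelian group and distributes over the addition (so $\mathbb F$ has no zero; examples are $\mathbb R_{>0}$ and $(\mathbb R,\max,+)$). Let $n\ge 0$ be an integer, let $Y=(\mathbb R_{\ge 0})^2\times\mathbb R$, $$A=\{(x,y,t)\in Y \mid x+y-n\le t\le n-(x+y)\},$$ $$S=\mathrm{conv}\{(n,0,0),(0,n,0),(0,0,-n)\},\qquad S'=\mathrm{conv}\{(n,0,0),(0,n,0),(0,0,n)\},$$ and let $\mathcal L=\{(x,y,t)\in\mathbb Z^3\cap Y\mid x+y+t\equiv n \bmod 2\}$. For $D\subset Y$ let $\mathcal H(D)=\mathbb F^{D\cap\mathcal L}$ be the set of states of $D$, and $P\mathcal H(D)=\mathcal H(D)/\mathbb F^\times$ its quotient by the action of the multiplicative group of $\mathbb F$ by scalar multiplication. The bounded octahedron recurrence for a state $f$ of $A$ is the rule $$f(x,y,t+1)\,f(x,y,t-1)=\begin{cases} f(x+1,y,t)f(x-1,y,t)+f(x,y+1,t)f(x,y-1,t) & \text{if } x>0,\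 y>0,\\ f(x+1,0,t)f(x-1,0,t) & \text{if } x>0,\ y=0,\\ f(0,y+1,t)f(0,y-1,t) & \text{if } x=0,\ y>0,\\ f(1,0,t)f(0,1,t) & \text{if } x=y=0,\end{cases}$$ whenever $(x,y,t\pm1)\in A\cap\mathcal L$. Every $f\in\mathcal H(S)$ extends uniquely to a state of $A$ satisfying this recurrence; let $\phi(f)\in\mathcal H(S')$ be the restriction of this extension to $S'$. Since $\phi(cf)=c\,\phi(f)$ for $c\in\mathbb F$, it induces a map $\overline\phi:P\mathcal H(S)\to P\mathcal H(S')$. Let $$r:S\to S,\ (n,0,0)\mapsto(0,n,0)\mapsto(0,0,-n)\mapsto(n,0,0),\qquad r':S'\to S',\ (n,0,0)\mapsto(0,0,n)\mapsto(0,n,0)\mapsto(n,0,0)$$ be the rotations of the two triangles, that is, $r(x,y,t)=(-t,x,-y)$ and $r'(x,y,t)=(y,t,x)$, and let $r^*$ and $r'^*$ be the maps that they induce on $P\mathcal H(S)$ and on $P\mathcal H(S')$ by $f\mapsto f\circ r$ and $f\mapsto f\circ r'$. Then $\phi:\mathcal H(S)\to\mathcal H(S')$ and $\overline\phi:P\mathcal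 H(S)\to P\mathcal H(S')$ are bijections, and $$r'^*\circ\overline\phi=\overline\phi\circ r^*.$$ -/

import Mathlib

/-!
# The bounded octahedron recurrence in a quarter-octahedron
-/

noncomputable section

namespace Octahedron

/-! ### Semifields (without zero) -/

/-- A semifield: a set with a commutative associative addition, and a multiplication that makes
the *whole* set an abelian group and that distributes over the addition.  There is no zero, so this
is not Mathlib's `Semifield`.  Examples: the positive reals, and `ℝ` with `max` and `+`. -/
class ZeroFreeSemifield (F : Type*) extends AddCommSemigroup F, CommGroup F, Distrib F

/-! ### Space-time, lattice, states -/

/-- The space-time `Y = (ℝ_{≥0})² × ℝ`, with coordinates `(x, y, t)`. -/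
def spaceTime : Set (ℝ × ℝ × ℝ) := {p | 0 ≤ p.1 ∧ 0 ≤ p.2.1}

/-- The quarter-octahedron `A = {(x, y, t) ∈ Y | x + y - n ≤ t ≤ n - (x + y)}`. -/
def quarterOctahedron (n : ℕ) : Set (ℝ × ℝ × ℝ) :=
  {p | p ∈ spaceTime ∧ p.1 + p.2.1 - n ≤ p.2.2 ∧ p.2.2 ≤ n - (p.1 + p.2.1)}

/-- The triangle `S = conv {(n,0,0), (0,n,0), (0,0,-n)}`. -/
def lowerTriangle (n : ℕ) : Set (ℝ × ℝ × ℝ) :=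
  convexHull ℝ {((n : ℝ), 0, 0), (0, (n : ℝ), 0), (0, 0, -(n : ℝ))}

/-- The triangle `S' = conv {(n,0,0), (0,n,0), (0,0,n)}`. -/
def upperTriangle (n : ℕ) : Set (ℝ × ℝ × ℝ) :=
  convexHull ℝ {((n : ℝ), 0, 0), (0, (n : ℝ), 0), (0, 0, (n : ℝ))}

/-- The points of `D` that lie in the lattice `{(x, y, t) ∈ ℤ³ | x + y + t ≡ n mod 2}`.
The parity is the one for which the vertices of the two triangles are lattice points; for even `n`
the condition says that `x + y + t` is even. -/
def latticePoints (n : ℕ) (D : Set (ℝ × ℝ × ℝ)) : Set (ℤ × ℤ × ℤ) :=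
  {p | ((p.1 : ℝ), (p.2.1 : ℝ), (p.2.2 : ℝ)) ∈ D ∧ p.1 + p.2.1 + p.2.2 ≡ (n : ℤ) [ZMOD 2]}

/-- The set `H(D)` of states of `D`: the `F`-valued functions on the lattice points of `D`. -/
abbrev State (F : Type*) (n : ℕ) (D : Set (ℝ × ℝ × ℝ)) : Type _ := latticePoints n D → F

/-- `P H(D)`, the quotient of `H(D)` by the action of the multiplicative group of `F`
by (pointwise) scalar multiplication. -/
abbrev ProjState (F : Type*) [ZeroFreeSemifield F] (n : ℕ) (D : Set (ℝ × ℝ × ℝ)) : Type _ :=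
  MulAction.orbitRel.Quotient F (State F n D)

/-- The class of a state in `P H(D)`. -/
def projClass {F : Type*} [ZeroFreeSemifield F] {n : ℕ} {D : Set (ℝ × ℝ × ℝ)}
    (f : State F n D) : ProjState F n D :=
  Quotient.mk _ f

/-- The restriction of a state to a smaller domain. -/
def restrict {F : Type*} {n : ℕ} {D E : Set (ℝ × ℝ × ℝ)}
    (h : latticePoints n E ⊆ latticePoints n D) (g : State F n D) : State F n E :=
  fun p => g ⟨p, h p.2⟩

/-! ### The recurrence -/

/-- The bounded octahedron recurrence for a state `g` of a domain `D` in the space-time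
`Y = (ℝ_{≥0})² × ℝ`: there is one rule for the interior of the quadrant, one for each of its two
walls and one for its corner, imposed wherever all the points involved are lattice points of `D`. -/
structure SatisfiesRecurrence {F : Type*} [ZeroFreeSemifield F] {n : ℕ} {D : Set (ℝ × ℝ × ℝ)}
    (g : State F n D) : Prop where
  interior : ∀ (x y t : ℤ), 0 < x → 0 < y →
    ∀ (hu : (x, y, t + 1) ∈ latticePoints n D) (hd : (x, y, t - 1) ∈ latticePoints n D)
      (he : (x + 1, y, t) ∈ latticePoints n D) (hw : (x - 1, y, t) ∈ latticePoints n D)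
      (hn : (x, y + 1, t) ∈ latticePoints n D) (hs : (x, y - 1, t) ∈ latticePoints n D),
    g ⟨_, hu⟩ = (g ⟨_, he⟩ * g ⟨_, hw⟩ + g ⟨_, hn⟩ * g ⟨_, hs⟩) / g ⟨_, hd⟩
  wall_y : ∀ (x t : ℤ), 0 < x →
    ∀ (hu : (x, 0, t + 1) ∈ latticePoints n D) (hd : (x, 0, t - 1) ∈ latticePoints n D)
      (he : (x + 1, 0, t) ∈ latticePoints n D) (hw : (x - 1, 0, t) ∈ latticePoints n D),
    g ⟨_, hu⟩ = g ⟨_, he⟩ * g ⟨_, hw⟩ / g ⟨_, hd⟩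
  wall_x : ∀ (y t : ℤ), 0 < y →
    ∀ (hu : (0, y, t + 1) ∈ latticePoints n D) (hd : (0, y, t - 1) ∈ latticePoints n D)
      (hn : (0, y + 1, t) ∈ latticePoints n D) (hs : (0, y - 1, t) ∈ latticePoints n D),
    g ⟨_, hu⟩ = g ⟨_, hn⟩ * g ⟨_, hs⟩ / g ⟨_, hd⟩
  corner : ∀ (t : ℤ),
    ∀ (hu : (0, 0, t + 1) ∈ latticePoints n D) (hd : (0, 0, t - 1) ∈ latticePoints n D)
      (he : (1, 0, t) ∈ latticePoints n D) (hn : (0, 1, t) ∈ latticePoints n D),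
    g ⟨_, hu⟩ = g ⟨_, he⟩ * g ⟨_, hn⟩ / g ⟨_, hd⟩

/-! ### Lattice points of the three domains -/

theorem convex_comb_mem_convexHull {u v w : ℝ × ℝ × ℝ} {a b c : ℝ} (ha : 0 ≤ a) (hb : 0 ≤ b)
    (hc : 0 ≤ c) (h : a + b + c = 1) : a • u + b • v + c • w ∈ convexHull ℝ {u, v, w} := by
  have := (convex_convexHull ℝ ({u, v, w} : Set (ℝ × ℝ × ℝ))).sum_mem (t := Finset.univ)
    (w := ![a, b, c]) (z := ![u, v, w])
    (by intro i _; fin_cases i <;> simpa) (by simp [Fin.sum_univ_three, h])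
    (by intro i _; fin_cases i <;> exact subset_convexHull ℝ _ (by simp))
  simpa [Fin.sum_univ_three] using this

theorem mem_lowerTriangle {n : ℕ} {x y t : ℝ} :
    (x, y, t) ∈ lowerTriangle n ↔ 0 ≤ x ∧ 0 ≤ y ∧ t ≤ 0 ∧ t = x + y - n := by
  constructor
  · intro h
    have hconv : Convex ℝ {p : ℝ × ℝ × ℝ | 0 ≤ p.1 ∧ 0 ≤ p.2.1 ∧ p.2.2 ≤ 0 ∧
        p.2.2 = p.1 + p.2.1 - n} := by
      rintro ⟨x, y, t⟩ ⟨h1, h2, h3, h4⟩ ⟨x', y', t'⟩ ⟨h1', h2', h3', h4'⟩ a b ha hb hab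
      simp only [Set.mem_ofPred_eq, Prod.smul_mk, Prod.mk_add_mk, smul_eq_mul] at *
      refine ⟨by positivity, by positivity, ?_, ?_⟩
      · nlinarith
      · rw [h4, h4', eq_sub_of_add_eq hab]; ring
    refine convexHull_min ?_ hconv h
    rintro p (rfl | rfl | rfl) <;> simp
  · rintro ⟨hx, hy, ht, rfl⟩
    rcases Nat.eq_zero_or_pos n with rfl | hn
    · simp only [Nat.cast_zero, sub_zero] at ht ⊢
      obtain rfl : x = 0 := by linarith
      obtain rfl : y = 0 := by linarith
      exact subset_convexHull ℝ _ (by simp)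
    · have hn' : (0 : ℝ) < n := by exact_mod_cast hn
      have := convex_comb_mem_convexHull (u := ((n : ℝ), 0, 0)) (v := (0, (n : ℝ), 0))
        (w := (0, 0, -(n : ℝ))) (a := x / n) (b := y / n) (c := -(x + y - n) / n)
        (by positivity) (by positivity) (div_nonneg (by linarith) hn'.le) (by field_simp; ring)
      refine Set.mem_of_eq_of_mem ?_ this
      simp only [Prod.smul_mk, Prod.mk_add_mk, smul_eq_mul, Prod.mk.injEq]
      refine ⟨?_, ?_, ?_⟩ <;> field_simp <;> ring

theorem mem_upperTriangle {n : ℕ} {x y t : ℝ} :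
    (x, y, t) ∈ upperTriangle n ↔ 0 ≤ x ∧ 0 ≤ y ∧ 0 ≤ t ∧ t = n - (x + y) := by
  constructor
  · intro h
    have hconv : Convex ℝ {p : ℝ × ℝ × ℝ | 0 ≤ p.1 ∧ 0 ≤ p.2.1 ∧ 0 ≤ p.2.2 ∧
        p.2.2 = n - (p.1 + p.2.1)} := by
      rintro ⟨x, y, t⟩ ⟨h1, h2, h3, h4⟩ ⟨x', y', t'⟩ ⟨h1', h2', h3', h4'⟩ a b ha hb hab
      simp only [Set.mem_ofPred_eq, Prod.smul_mk, Prod.mk_add_mk, smul_eq_mul] at *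
      refine ⟨by positivity, by positivity, by positivity, ?_⟩
      rw [h4, h4', eq_sub_of_add_eq hab]; ring
    refine convexHull_min ?_ hconv h
    rintro p (rfl | rfl | rfl) <;> simp
  · rintro ⟨hx, hy, ht, rfl⟩
    rcases Nat.eq_zero_or_pos n with rfl | hn
    · simp only [Nat.cast_zero, zero_sub] at ht ⊢
      obtain rfl : x = 0 := by linarith
      obtain rfl : y = 0 := by linarith
      exact subset_convexHull ℝ _ (by simp)
    · have hn' : (0 : ℝ) < n := by exact_mod_cast hn
      have := convex_comb_mem_convexHull (u := ((n : ℝ), 0, 0)) (v := (0, (n : ℝ), 0))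
        (w := (0, 0, (n : ℝ))) (a := x / n) (b := y / n) (c := (n - (x + y)) / n)
        (by positivity) (by positivity) (div_nonneg (by linarith) hn'.le) (by field_simp; ring)
      refine Set.mem_of_eq_of_mem ?_ this
      simp only [Prod.smul_mk, Prod.mk_add_mk, smul_eq_mul, Prod.mk.injEq]
      refine ⟨?_, ?_, ?_⟩ <;> field_simp <;> ring

theorem mem_latticePoints_quarter {n : ℕ} {x y t : ℤ} :
    (x, y, t) ∈ latticePoints n (quarterOctahedron n) ↔
      0 ≤ x ∧ 0 ≤ y ∧ x + y - n ≤ t ∧ t ≤ n - (x + y) ∧ (x + y + t - n) % 2 = 0 := by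
  simp only [latticePoints, quarterOctahedron, spaceTime, Set.mem_ofPred_eq, Int.ModEq]
  norm_cast
  omega

theorem mem_latticePoints_lower {n : ℕ} {x y t : ℤ} :
    (x, y, t) ∈ latticePoints n (lowerTriangle n) ↔
      0 ≤ x ∧ 0 ≤ y ∧ x + y ≤ n ∧ t = x + y - n := by
  simp only [latticePoints, Set.mem_ofPred_eq, Int.ModEq, mem_lowerTriangle]
  norm_cast
  omega

theorem mem_latticePoints_upper {n : ℕ} {x y t : ℤ} :
    (x, y, t) ∈ latticePoints n (upperTriangle n) ↔
      0 ≤ x ∧ 0 ≤ y ∧ x + y ≤ n ∧ t = n - (x + y) := by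
  simp only [latticePoints, Set.mem_ofPred_eq, Int.ModEq, mem_upperTriangle]
  norm_cast
  omega

theorem lower_subset (n : ℕ) :
    latticePoints n (lowerTriangle n) ⊆ latticePoints n (quarterOctahedron n) := by
  rintro ⟨x, y, t⟩ h
  rw [mem_latticePoints_lower] at h
  rw [mem_latticePoints_quarter]
  omega

theorem upper_subset (n : ℕ) :
    latticePoints n (upperTriangle n) ⊆ latticePoints n (quarterOctahedron n) := by
  rintro ⟨x, y, t⟩ h
  rw [mem_latticePoints_upper] at h
  rw [mem_latticePoints_quarter]
  omega

/-! ### A state of the lower triangle extends uniquely to the quarter-octahedron -/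

/-- Auxiliary recursion on natural number coordinates: the value at `(x, y, x + y - n + 2 k)`,
in terms of the initial values `s x y` (those for `k = 0`). -/
def evolve {F : Type*} [ZeroFreeSemifield F] (s : ℕ → ℕ → F) : ℕ → ℕ → ℕ → F
  | 0, x, y => s x y
  | k + 1, 0, 0 => evolve s k 1 0 * evolve s k 0 1 / evolve s k 0 0
  | k + 1, x + 1, 0 => evolve s k (x + 2) 0 * evolve s (k + 1) x 0 / evolve s k (x + 1) 0
  | k + 1, 0, y + 1 => evolve s k 0 (y + 2) * evolve s (k + 1) 0 y / evolve s k 0 (y + 1)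
  | k + 1, x + 1, y + 1 =>
      (evolve s k (x + 2) (y + 1) * evolve s (k + 1) x (y + 1) +
        evolve s k (x + 1) (y + 2) * evolve s (k + 1) (x + 1) y) / evolve s k (x + 1) (y + 1)
termination_by k x y => (k, x + y)

open Classical in
/-- The values of a state of the lower triangle, on natural number coordinates. -/
def seed {F : Type*} [ZeroFreeSemifield F] {n : ℕ} (f : State F n (lowerTriangle n))
    (x y : ℕ) : F :=
  if h : ((x : ℤ), (y : ℤ), (x : ℤ) + y - n) ∈ latticePoints n (lowerTriangle n) then f ⟨_, h⟩
  else 1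

/-- The state of the quarter-octahedron obtained from a state of the lower triangle. -/
def evolved {F : Type*} [ZeroFreeSemifield F] {n : ℕ} (f : State F n (lowerTriangle n)) :
    State F n (quarterOctahedron n) :=
  fun p => evolve (seed f) ((p.1.2.2 - (p.1.1 + p.1.2.1 - n)) / 2).toNat p.1.1.toNat p.1.2.1.toNat

theorem evolved_apply {F : Type*} [ZeroFreeSemifield F] {n : ℕ} (f : State F n (lowerTriangle n))
    (p : latticePoints n (quarterOctahedron n)) (k x y : ℕ)
    (h : p.1 = ((x : ℤ), (y : ℤ), (x : ℤ) + y - n + 2 * k)) :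
    evolved f p = evolve (seed f) k x y := by
  simp only [evolved, h]
  congr 1
  omega

theorem exists_coords {n : ℕ} {x y t : ℤ} (h : (x, y, t) ∈ latticePoints n (quarterOctahedron n)) :
    ∃ k a b : ℕ, x = a ∧ y = b ∧ t = (a : ℤ) + b - n + 2 * k := by
  rw [mem_latticePoints_quarter] at h
  exact ⟨((t - (x + y - n)) / 2).toNat, x.toNat, y.toNat, by omega, by omega, by omega⟩

theorem evolved_satisfies {F : Type*} [ZeroFreeSemifield F] {n : ℕ}
    (f : State F n (lowerTriangle n)) : SatisfiesRecurrence (evolved f) := by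
  refine ⟨?_, ?_, ?_, ?_⟩
  · intro x y t hx hy hu hd he hw hn hs
    obtain ⟨k, a, b, rfl, rfl, ht⟩ := exists_coords hd
    obtain ⟨a, rfl⟩ := Nat.exists_eq_succ_of_ne_zero (show a ≠ 0 by omega)
    obtain ⟨b, rfl⟩ := Nat.exists_eq_succ_of_ne_zero (show b ≠ 0 by omega)
    obtain rfl : t = (a : ℤ) + 1 + (b + 1) - n + 2 * k + 1 := by push_cast at ht; linarith
    rw [evolved_apply f ⟨_, hu⟩ (k + 1) (a + 1) (b + 1) (by ext <;> push_cast <;> ring),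
      evolved_apply f ⟨_, hd⟩ k (a + 1) (b + 1) (by ext <;> push_cast <;> ring),
      evolved_apply f ⟨_, he⟩ k (a + 2) (b + 1) (by ext <;> push_cast <;> ring),
      evolved_apply f ⟨_, hw⟩ (k + 1) a (b + 1) (by ext <;> push_cast <;> ring),
      evolved_apply f ⟨_, hn⟩ k (a + 1) (b + 2) (by ext <;> push_cast <;> ring),
      evolved_apply f ⟨_, hs⟩ (k + 1) (a + 1) b (by ext <;> push_cast <;> ring), evolve]
  · intro x t hx hu hd he hw
    obtain ⟨k, a, b, rfl, hb, ht⟩ := exists_coords hd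
    obtain ⟨a, rfl⟩ := Nat.exists_eq_succ_of_ne_zero (show a ≠ 0 by omega)
    obtain rfl : t = (a : ℤ) + 1 - n + 2 * k + 1 := by push_cast at ht; linarith
    rw [evolved_apply f ⟨_, hu⟩ (k + 1) (a + 1) 0 (by ext <;> push_cast <;> ring),
      evolved_apply f ⟨_, hd⟩ k (a + 1) 0 (by ext <;> push_cast <;> ring),
      evolved_apply f ⟨_, he⟩ k (a + 2) 0 (by ext <;> push_cast <;> ring),
      evolved_apply f ⟨_, hw⟩ (k + 1) a 0 (by ext <;> push_cast <;> ring), evolve]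
  · intro y t hy hu hd hn hs
    obtain ⟨k, a, b, ha, rfl, ht⟩ := exists_coords hd
    obtain ⟨b, rfl⟩ := Nat.exists_eq_succ_of_ne_zero (show b ≠ 0 by omega)
    obtain rfl : t = (b : ℤ) + 1 - n + 2 * k + 1 := by push_cast at ht; linarith
    rw [evolved_apply f ⟨_, hu⟩ (k + 1) 0 (b + 1) (by ext <;> push_cast <;> ring),
      evolved_apply f ⟨_, hd⟩ k 0 (b + 1) (by ext <;> push_cast <;> ring),
      evolved_apply f ⟨_, hn⟩ k 0 (b + 2) (by ext <;> push_cast <;> ring),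
      evolved_apply f ⟨_, hs⟩ (k + 1) 0 b (by ext <;> push_cast <;> ring), evolve]
  · intro t hu hd he hn
    obtain ⟨k, a, b, ha, hb, ht⟩ := exists_coords hd
    obtain rfl : t = -(n : ℤ) + 2 * k + 1 := by linarith
    rw [evolved_apply f ⟨_, hu⟩ (k + 1) 0 0 (by ext <;> push_cast <;> ring),
      evolved_apply f ⟨_, hd⟩ k 0 0 (by ext <;> push_cast <;> ring),
      evolved_apply f ⟨_, he⟩ k 1 0 (by ext <;> push_cast <;> ring),
      evolved_apply f ⟨_, hn⟩ k 0 1 (by ext <;> push_cast <;> ring), evolve]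

theorem restrict_evolved {F : Type*} [ZeroFreeSemifield F] {n : ℕ}
    (f : State F n (lowerTriangle n)) : restrict (lower_subset n) (evolved f) = f := by
  funext ⟨⟨x, y, t⟩, h⟩
  have h' := mem_latticePoints_lower.1 h
  obtain ⟨a, rfl⟩ := Int.eq_ofNat_of_zero_le h'.1
  obtain ⟨b, rfl⟩ := Int.eq_ofNat_of_zero_le h'.2.1
  obtain rfl : t = (a : ℤ) + b - n := h'.2.2.2
  rw [restrict, evolved_apply f _ 0 a b (by simp), evolve, seed, dif_pos h]

theorem eq_evolve_of_satisfies {F : Type*} [ZeroFreeSemifield F] {n : ℕ}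
    {g : State F n (quarterOctahedron n)} (hg : SatisfiesRecurrence g) (k x y : ℕ)
    (h : ((x : ℤ), (y : ℤ), (x : ℤ) + y - n + 2 * k) ∈ latticePoints n (quarterOctahedron n)) :
    g ⟨_, h⟩ = evolve (seed (restrict (lower_subset n) g)) k x y := by
  have key : ∀ (k x y : ℕ) (p : latticePoints n (quarterOctahedron n)),
      p.1 = ((x : ℤ), (y : ℤ), (x : ℤ) + y - n + 2 * k) →
      g p = evolve (seed (restrict (lower_subset n) g)) k x y := by
    clear h k x y
    intro k
    induction k with
    | zero =>
      rintro x y ⟨p, hp⟩ h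
      simp only [Nat.cast_zero, mul_zero, add_zero] at h
      subst h
      have hm : ((x : ℤ), (y : ℤ), (x : ℤ) + y - n) ∈ latticePoints n (lowerTriangle n) := by
        rw [mem_latticePoints_quarter] at hp
        rw [mem_latticePoints_lower]
        omega
      rw [evolve, seed, dif_pos hm]
      rfl
    | succ k ih =>
      intro x y
      induction hN : x + y using Nat.strong_induction_on generalizing x y with
      | _ N ih2 =>
      rintro ⟨⟨a, b, t⟩, hp⟩ h
      obtain ⟨t, rfl⟩ : ∃ s, t = s + 1 := ⟨t - 1, by ring⟩
      simp only [Prod.mk.injEq] at h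
      obtain ⟨h1, h2, h3⟩ := h
      have hq := mem_latticePoints_quarter.1 hp
      rcases x with _ | x <;> rcases y with _ | y
      · obtain rfl : a = 0 := by omega
        obtain rfl : b = 0 := by omega
        have hd : ((0 : ℤ), (0 : ℤ), t - 1) ∈ latticePoints n (quarterOctahedron n) := by
          rw [mem_latticePoints_quarter]; omega
        have he : ((1 : ℤ), (0 : ℤ), t) ∈ latticePoints n (quarterOctahedron n) := by
          rw [mem_latticePoints_quarter]; omega
        have hn : ((0 : ℤ), (1 : ℤ), t) ∈ latticePoints n (quarterOctahedron n) := by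
          rw [mem_latticePoints_quarter]; omega
        rw [hg.corner _ hp hd he hn, ih 0 0 ⟨_, hd⟩ (by simp only [Prod.mk.injEq]; omega),
          ih 1 0 ⟨_, he⟩ (by simp only [Prod.mk.injEq]; omega),
          ih 0 1 ⟨_, hn⟩ (by simp only [Prod.mk.injEq]; omega), evolve]
      · obtain rfl : a = 0 := by omega
        have hd : ((0 : ℤ), b, t - 1) ∈ latticePoints n (quarterOctahedron n) := by
          rw [mem_latticePoints_quarter]; omega
        have hn : ((0 : ℤ), b + 1, t) ∈ latticePoints n (quarterOctahedron n) := by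
          rw [mem_latticePoints_quarter]; omega
        have hs : ((0 : ℤ), b - 1, t) ∈ latticePoints n (quarterOctahedron n) := by
          rw [mem_latticePoints_quarter]; omega
        rw [hg.wall_x _ _ (by omega) hp hd hn hs,
          ih 0 (y + 1) ⟨_, hd⟩ (by simp only [Prod.mk.injEq]; omega),
          ih 0 (y + 2) ⟨_, hn⟩ (by simp only [Prod.mk.injEq]; omega),
          ih2 (0 + y) (by omega) 0 y rfl ⟨_, hs⟩ (by simp only [Prod.mk.injEq]; omega), evolve]
      · obtain rfl : b = 0 := by omega
        have hd : (a, (0 : ℤ), t - 1) ∈ latticePoints n (quarterOctahedron n) := by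
          rw [mem_latticePoints_quarter]; omega
        have he : (a + 1, (0 : ℤ), t) ∈ latticePoints n (quarterOctahedron n) := by
          rw [mem_latticePoints_quarter]; omega
        have hw : (a - 1, (0 : ℤ), t) ∈ latticePoints n (quarterOctahedron n) := by
          rw [mem_latticePoints_quarter]; omega
        rw [hg.wall_y _ _ (by omega) hp hd he hw,
          ih (x + 1) 0 ⟨_, hd⟩ (by simp only [Prod.mk.injEq]; omega),
          ih (x + 2) 0 ⟨_, he⟩ (by simp only [Prod.mk.injEq]; omega),
          ih2 (x + 0) (by omega) x 0 rfl ⟨_, hw⟩ (by simp only [Prod.mk.injEq]; omega), evolve]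
      · have hd : (a, b, t - 1) ∈ latticePoints n (quarterOctahedron n) := by
          rw [mem_latticePoints_quarter]; omega
        have he : (a + 1, b, t) ∈ latticePoints n (quarterOctahedron n) := by
          rw [mem_latticePoints_quarter]; omega
        have hw : (a - 1, b, t) ∈ latticePoints n (quarterOctahedron n) := by
          rw [mem_latticePoints_quarter]; omega
        have hn : (a, b + 1, t) ∈ latticePoints n (quarterOctahedron n) := by
          rw [mem_latticePoints_quarter]; omega
        have hs : (a, b - 1, t) ∈ latticePoints n (quarterOctahedron n) := by
          rw [mem_latticePoints_quarter]; omega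
        rw [hg.interior _ _ _ (by omega) (by omega) hp hd he hw hn hs,
          ih (x + 1) (y + 1) ⟨_, hd⟩ (by simp only [Prod.mk.injEq]; omega),
          ih (x + 2) (y + 1) ⟨_, he⟩ (by simp only [Prod.mk.injEq]; omega),
          ih (x + 1) (y + 2) ⟨_, hn⟩ (by simp only [Prod.mk.injEq]; omega),
          ih2 (x + (y + 1)) (by omega) x (y + 1) rfl ⟨_, hw⟩
            (by simp only [Prod.mk.injEq]; omega),
          ih2 (x + 1 + y) (by omega) (x + 1) y rfl ⟨_, hs⟩
            (by simp only [Prod.mk.injEq]; omega), evolve]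
  exact key k x y ⟨_, h⟩ rfl

theorem existsUnique_extension {F : Type*} [ZeroFreeSemifield F] {n : ℕ}
    (f : State F n (lowerTriangle n)) :
    ∃! g : State F n (quarterOctahedron n),
      SatisfiesRecurrence g ∧ restrict (lower_subset n) g = f := by
  refine ⟨evolved f, ⟨evolved_satisfies f, restrict_evolved f⟩, ?_⟩
  rintro g ⟨hg, rfl⟩
  funext ⟨⟨x, y, t⟩, h⟩
  obtain ⟨k, a, b, rfl, rfl, rfl⟩ := exists_coords h
  rw [eq_evolve_of_satisfies hg, evolved_apply _ _ k a b rfl]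

/-! ### The maps `φ` and `φ̄` -/

/-- The unique state of the quarter-octahedron that satisfies the bounded octahedron recurrence
and extends the state `f` of the lower triangle. -/
def extend {F : Type*} [ZeroFreeSemifield F] {n : ℕ} (f : State F n (lowerTriangle n)) :
    State F n (quarterOctahedron n) :=
  (existsUnique_extension f).choose

theorem extend_spec {F : Type*} [ZeroFreeSemifield F] {n : ℕ} (f : State F n (lowerTriangle n)) :
    SatisfiesRecurrence (extend f) ∧ restrict (lower_subset n) (extend f) = f :=
  (existsUnique_extension f).choose_spec.1

theorem eq_extend {F : Type*} [ZeroFreeSemifield F] {n : ℕ} {f : State F n (lowerTriangle n)}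
    {g : State F n (quarterOctahedron n)} (hg : SatisfiesRecurrence g)
    (h : restrict (lower_subset n) g = f) : g = extend f :=
  (existsUnique_extension f).choose_spec.2 g ⟨hg, h⟩

/-- The map `φ : H(S) → H(S')` defined by the bounded octahedron recurrence on `A`. -/
def phi {F : Type*} [ZeroFreeSemifield F] {n : ℕ} (f : State F n (lowerTriangle n)) :
    State F n (upperTriangle n) :=
  restrict (upper_subset n) (extend f)

theorem smul_mul_smul_div {F : Type*} [ZeroFreeSemifield F] (c a b d : F) :
    c * a * (c * b) / (c * d) = c * (a * b / d) := by
  rw [div_eq_iff_eq_mul]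
  calc c * a * (c * b) = c * (c * (a * b)) := by
        rw [mul_mul_mul_comm, mul_assoc]
    _ = c * (a * b / d) * (c * d) := by
        rw [mul_mul_mul_comm, div_mul_cancel, mul_assoc]

theorem SatisfiesRecurrence.smul {F : Type*} [ZeroFreeSemifield F] {n : ℕ}
    {D : Set (ℝ × ℝ × ℝ)} {g : State F n D} (hg : SatisfiesRecurrence g) (c : F) :
    SatisfiesRecurrence (c • g) := by
  refine ⟨?_, ?_, ?_, ?_⟩
  · intro x y t hx hy hu hd he hw hn hs
    simp only [Pi.smul_apply, smul_eq_mul, hg.interior x y t hx hy hu hd he hw hn hs]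
    have h1 (a b : F) : c * a * (c * b) = c * (c * (a * b)) := by
      rw [mul_mul_mul_comm, mul_assoc]
    rw [h1, h1, ← mul_add, ← mul_add, mul_div_mul_left_eq_div, mul_div_assoc]
  · intro x t hx hu hd he hw
    simp only [Pi.smul_apply, smul_eq_mul, hg.wall_y x t hx hu hd he hw, smul_mul_smul_div]
  · intro y t hy hu hd hn hs
    simp only [Pi.smul_apply, smul_eq_mul, hg.wall_x y t hy hu hd hn hs, smul_mul_smul_div]
  · intro t hu hd he hn
    simp only [Pi.smul_apply, smul_eq_mul, hg.corner t hu hd he hn, smul_mul_smul_div]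

theorem phi_smul {F : Type*} [ZeroFreeSemifield F] {n : ℕ} (c : F)
    (f : State F n (lowerTriangle n)) : phi (c • f) = c • phi f := by
  have h := extend_spec f
  have : c • extend f = extend (c • f) := by
    refine eq_extend (h.1.smul c) ?_
    conv_rhs => rw [← h.2]
    rfl
  rw [phi, ← this]
  rfl

/-- The map `φ̄ : P H(S) → P H(S')` induced by `φ`. -/
def phiBar {F : Type*} [ZeroFreeSemifield F] {n : ℕ} :
    ProjState F n (lowerTriangle n) → ProjState F n (upperTriangle n) :=
  Quotient.map phi (by
    rintro _ f ⟨c, rfl⟩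
    exact ⟨c, (phi_smul c f).symm⟩)

/-! ### The rotations and their pullbacks -/

/-- The linear map whose restriction to `S` is the rotation
`r : (n,0,0) ↦ (0,n,0) ↦ (0,0,-n) ↦ (n,0,0)`. -/
def rotLower : (ℝ × ℝ × ℝ) →ₗ[ℝ] (ℝ × ℝ × ℝ) where
  toFun p := (-p.2.2, p.1, -p.2.1)
  map_add' p q := by ext <;> simp <;> ring
  map_smul' c p := by ext <;> simp

/-- The linear map whose restriction to `S'` is the rotation
`r' : (n,0,0) ↦ (0,0,n) ↦ (0,n,0) ↦ (n,0,0)`. -/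
def rotUpper : (ℝ × ℝ × ℝ) →ₗ[ℝ] (ℝ × ℝ × ℝ) where
  toFun p := (p.2.1, p.2.2, p.1)
  map_add' _ _ := rfl
  map_smul' _ _ := rfl

theorem rotLower_vertices (n : ℕ) :
    rotLower ((n : ℝ), 0, 0) = (0, (n : ℝ), 0) ∧ rotLower (0, (n : ℝ), 0) = (0, 0, -(n : ℝ)) ∧
      rotLower (0, 0, -(n : ℝ)) = ((n : ℝ), 0, 0) := by
  simp [rotLower]

theorem rotUpper_vertices (n : ℕ) :
    rotUpper ((n : ℝ), 0, 0) = (0, 0, (n : ℝ)) ∧ rotUpper (0, 0, (n : ℝ)) = (0, (n : ℝ), 0) ∧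
      rotUpper (0, (n : ℝ), 0) = ((n : ℝ), 0, 0) := by
  simp [rotUpper]

/-- The rotation `r` on the lattice points of `S`. -/
def r {n : ℕ} (p : latticePoints n (lowerTriangle n)) : latticePoints n (lowerTriangle n) :=
  ⟨(-p.1.2.2, p.1.1, -p.1.2.1), by
    obtain ⟨⟨x, y, t⟩, hp⟩ := p
    rw [mem_latticePoints_lower] at hp ⊢
    simp only
    omega⟩

/-- The rotation `r'` on the lattice points of `S'`. -/
def r' {n : ℕ} (p : latticePoints n (upperTriangle n)) : latticePoints n (upperTriangle n) :=
  ⟨(p.1.2.1, p.1.2.2, p.1.1), by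
    obtain ⟨⟨x, y, t⟩, hp⟩ := p
    rw [mem_latticePoints_upper] at hp ⊢
    simp only
    omega⟩

theorem coe_r {n : ℕ} (p : latticePoints n (lowerTriangle n)) :
    (((r p).1.1 : ℝ), ((r p).1.2.1 : ℝ), ((r p).1.2.2 : ℝ)) =
      rotLower ((p.1.1 : ℝ), (p.1.2.1 : ℝ), (p.1.2.2 : ℝ)) := by
  simp [r, rotLower]

theorem coe_r' {n : ℕ} (p : latticePoints n (upperTriangle n)) :
    (((r' p).1.1 : ℝ), ((r' p).1.2.1 : ℝ), ((r' p).1.2.2 : ℝ)) =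
      rotUpper ((p.1.1 : ℝ), (p.1.2.1 : ℝ), (p.1.2.2 : ℝ)) := by
  simp [r', rotUpper]

/-- The pullback of projectivized states along a self-map `ρ` of the lattice points of `D`:
the class of `f` is sent to the class of `f ∘ ρ`. -/
def pullback {F : Type*} [ZeroFreeSemifield F] {n : ℕ} {D : Set (ℝ × ℝ × ℝ)}
    (ρ : latticePoints n D → latticePoints n D) : ProjState F n D → ProjState F n D :=
  Quotient.map (fun f => f ∘ ρ) (by
    rintro _ f ⟨c, rfl⟩
    exact ⟨c, rfl⟩)

end Octahedron

end

/-! Write the data on `S` as an array `s x y` with `x + y ≤ n`. The lattice point `(x, y, z)` of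
`S'` is reached after `z` steps, so `φ` is read off from `evolve s z x y`. Multiplying by `s 0 0`
gives `tau`, and equivariance becomes the symmetry `tau s' z x y = tau s x y z`, where `s'` is the
rotated array (`tau_rotate`). The factors `s 0 0` and `s' 0 0` are exactly what projectivization
discards.

To prove the symmetry by induction, it is embedded in a family: `tau s' k x y` is compared with
`tau` at `(x, y, k)` of the array `s` shifted by `g` in its first index, where `x + y + k + g = n`.
The shifted array describes a triangle of size `n - g`. The left side obeys the octahedron
recurrence by construction. The right side obeys it because the evolutions of an array and of its
shift by one are linked by an octahedron relation of their own (`tau_oct`), with degenerate forms on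
the walls and at the corner.

The core is therefore `relOct_all`: with `T` and `U` the two evolutions, the linking relation
follows from three bilinear relations `RelA`, `RelB`, `RelC`, proved together by induction on the
layer. Addition in the semifield need not be cancellative (it may be `max`), so every step
multiplies by a nonzero factor, regroups without subtraction, and cancels that factor.

Bijectivity comes from the symmetry of the recurrence under `t ↦ -t`, which exchanges `S` and `S'`.
-/

namespace Octahedron

/-! ### Two coupled solutions of the octahedron recurrence -/

/-- Two arrays `T`, `U` over a commutative semiring, with indices `(k, x, y)`, that vanish for
`k = 0` and for `y = 0`, satisfy the octahedron recurrence, and are coupled along the layer `k = 1`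
and along the wall `x = 0`. -/
structure Coupled {K : Type*} [CommSemiring K] (T U : ℕ → ℕ → ℕ → K) : Prop where
  T_zero_right : ∀ k x, T k x 0 = 0
  U_zero_right : ∀ k x, U k x 0 = 0
  U_zero_left : ∀ x y, U 0 x y = 0
  T_ne_zero : ∀ k x y, T (k + 1) x (y + 1) ≠ 0
  U_ne_zero : ∀ k x y, U (k + 1) x (y + 1) ≠ 0
  T_rec : ∀ k x y, T (k + 2) (x + 1) (y + 1) * T (k + 1) (x + 1) (y + 1) =
    T (k + 1) (x + 2) (y + 1) * T (k + 2) x (y + 1) +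
      T (k + 1) (x + 1) (y + 2) * T (k + 2) (x + 1) y
  U_rec : ∀ k x y, U (k + 2) (x + 1) (y + 1) * U (k + 1) (x + 1) (y + 1) =
    U (k + 1) (x + 2) (y + 1) * U (k + 2) x (y + 1) +
      U (k + 1) (x + 1) (y + 2) * U (k + 2) (x + 1) y
  U_wall : ∀ k y, U (k + 2) 0 (y + 2) * U (k + 1) 0 (y + 2) =
    U (k + 1) 0 (y + 3) * U (k + 2) 0 (y + 1)
  wall : ∀ k y, T (k + 3) 0 (y + 1) * U (k + 1) 0 (y + 2) =
    T (k + 2) 0 (y + 2) * U (k + 2) 0 (y + 1)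
  layer : ∃ c : K, ∀ x y, U 1 x (y + 1) = c * T 1 (x + 1) (y + 1)

namespace Coupled

variable {K : Type*} [CommSemiring K] {T U : ℕ → ℕ → ℕ → K}

/-- The first of the three auxiliary bilinear relations at `(k, x, y)`. -/
def RelA (T U : ℕ → ℕ → ℕ → K) (k x y : ℕ) : Prop :=
  U (k + 1) (x + 1) (y + 1) * T (k + 1) (x + 1) (y + 1) =
    T (k + 1) (x + 2) (y + 1) * U (k + 1) x (y + 1) + U k (x + 1) (y + 2) * T (k + 2) (x + 1) y

/-- The second of the three auxiliary bilinear relations at `(k, x, y)`. -/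
def RelB (T U : ℕ → ℕ → ℕ → K) (k x y : ℕ) : Prop :=
  U (k + 1) x (y + 2) * T (k + 1) (x + 1) (y + 1) + U k (x + 1) (y + 2) * T (k + 2) x (y + 1) =
    T (k + 1) (x + 1) (y + 2) * U (k + 1) x (y + 1)

/-- The third of the three auxiliary bilinear relations at `(k, x, y)`. -/
def RelC (T U : ℕ → ℕ → ℕ → K) (k x y : ℕ) : Prop :=
  T (k + 2) (x + 1) (y + 1) * U (k + 1) x (y + 1) =
    T (k + 2) x (y + 1) * U (k + 1) (x + 1) (y + 1) + T (k + 2) (x + 1) y * U (k + 1) x (y + 2)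

/-- The octahedron relation in the direction of the coupling. -/
def RelOct (T U : ℕ → ℕ → ℕ → K) (k x y : ℕ) : Prop :=
  T (k + 1) (x + 1) (y + 2) * U (k + 1) (x + 1) (y + 1) =
    T (k + 1) (x + 2) (y + 1) * U (k + 1) x (y + 2) + T (k + 2) (x + 1) (y + 1) * U k (x + 1) (y + 2)

/-- In the lowest layer `U` is a multiple of a translate of `T` and the layer below it vanishes. The
first two relations become trivial, and the third is a multiple of the recurrence for `T`. -/
theorem rel_zero (h : Coupled T U) (x y : ℕ) :
    RelA T U 0 x y ∧ RelB T U 0 x y ∧ RelC T U 0 x y := by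
  obtain ⟨c, hc⟩ := h.layer
  have hR := h.T_rec 0 x y
  simp only [zero_add] at hR
  refine ⟨?_, ?_, ?_⟩
  · simp only [RelA, zero_add, h.U_zero_left, hc]; ring
  · simp only [RelB, zero_add, h.U_zero_left, hc x y, hc x (y + 1)]; ring
  · simp only [RelC, zero_add, hc x y, hc (x + 1) y, hc x (y + 1)]
    calc T 2 (x + 1) (y + 1) * (c * T 1 (x + 1) (y + 1))
        = c * (T 2 (x + 1) (y + 1) * T 1 (x + 1) (y + 1)) := by ring
      _ = _ := by rw [hR]; ring

variable [IsCancelMulZero K]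

/-- After multiplication by a value of `T`, the recurrence for `T` splits one summand; `RelB` then
merges two terms and `RelA` recovers the common factor. -/
theorem relOct (h : Coupled T U) {k x y : ℕ} (hA : RelA T U k x y) (hB : RelB T U k x y) :
    RelOct T U k x y := by
  refine mul_right_cancel₀ (h.T_ne_zero k (x + 1) y) ?_
  have hR := h.T_rec k x y
  simp only [RelA, RelB] at hA hB
  symm
  calc (T (k + 1) (x + 2) (y + 1) * U (k + 1) x (y + 2) +
        T (k + 2) (x + 1) (y + 1) * U k (x + 1) (y + 2)) * T (k + 1) (x + 1) (y + 1)
      = T (k + 1) (x + 2) (y + 1) * U (k + 1) x (y + 2) * T (k + 1) (x + 1) (y + 1) +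
        U k (x + 1) (y + 2) * (T (k + 2) (x + 1) (y + 1) * T (k + 1) (x + 1) (y + 1)) := by ring
    _ = T (k + 1) (x + 2) (y + 1) *
          (U (k + 1) x (y + 2) * T (k + 1) (x + 1) (y + 1) +
            U k (x + 1) (y + 2) * T (k + 2) x (y + 1)) +
        U k (x + 1) (y + 2) * T (k + 1) (x + 1) (y + 2) * T (k + 2) (x + 1) y := by
      rw [hR]; ring
    _ = T (k + 1) (x + 1) (y + 2) * (T (k + 1) (x + 2) (y + 1) * U (k + 1) x (y + 1) +
          U k (x + 1) (y + 2) * T (k + 2) (x + 1) y) := by rw [hB]; ring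
    _ = T (k + 1) (x + 1) (y + 2) * U (k + 1) (x + 1) (y + 1) * T (k + 1) (x + 1) (y + 1) := by
      rw [← hA]; ring

theorem relC_succ (h : Coupled T U) {k x y : ℕ} (hA : RelA T U (k + 1) x y)
    (hB : RelB T U (k + 1) x y) : RelC T U (k + 1) x y := by
  refine mul_right_cancel₀ (h.T_ne_zero (k + 1) (x + 1) y) ?_
  have hR := h.T_rec (k + 1) x y
  simp only [RelA, RelB] at hA hB
  calc T (k + 3) (x + 1) (y + 1) * U (k + 2) x (y + 1) * T (k + 2) (x + 1) (y + 1)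
      = U (k + 2) x (y + 1) * (T (k + 3) (x + 1) (y + 1) * T (k + 2) (x + 1) (y + 1)) := by ring
    _ = U (k + 2) x (y + 1) * T (k + 2) (x + 2) (y + 1) * T (k + 3) x (y + 1) +
        T (k + 3) (x + 1) y * (T (k + 2) (x + 1) (y + 2) * U (k + 2) x (y + 1)) := by rw [hR]; ring
    _ = T (k + 3) x (y + 1) * (T (k + 2) (x + 2) (y + 1) * U (k + 2) x (y + 1) +
          U (k + 1) (x + 1) (y + 2) * T (k + 3) (x + 1) y) +
        T (k + 3) (x + 1) y * U (k + 2) x (y + 2) * T (k + 2) (x + 1) (y + 1) := by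
      rw [← hB]; ring
    _ = (T (k + 3) x (y + 1) * U (k + 2) (x + 1) (y + 1) +
          T (k + 3) (x + 1) y * U (k + 2) x (y + 2)) * T (k + 2) (x + 1) (y + 1) := by
      rw [← hA]; ring

/-- The recurrence for `U` produces a product that the octahedron relation one step lower in `y`
rewrites; `RelC` of the previous layer refolds the result. -/
theorem relA_succ (h : Coupled T U) {k x y : ℕ} (hC : RelC T U k (x + 1) y)
    (hO : ∀ z, y = z + 1 → RelOct T U (k + 1) x z) : RelA T U (k + 1) x y := by
  refine mul_right_cancel₀ (h.U_ne_zero k (x + 1) y) ?_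
  have hR := h.U_rec k x y
  have hO' : T (k + 2) (x + 1) (y + 1) * U (k + 2) (x + 1) y =
      T (k + 2) (x + 2) y * U (k + 2) x (y + 1) + T (k + 3) (x + 1) y * U (k + 1) (x + 1) (y + 1) := by
    cases y with
    -- There is no lower `y` here, but each of the three terms has a factor with last index zero.
    | zero => simp only [h.T_zero_right, h.U_zero_right, zero_mul, mul_zero, add_zero]
    | succ z => exact hO z rfl
  simp only [RelC] at hC
  calc U (k + 2) (x + 1) (y + 1) * T (k + 2) (x + 1) (y + 1) * U (k + 1) (x + 1) (y + 1)
      = T (k + 2) (x + 1) (y + 1) * (U (k + 2) (x + 1) (y + 1) * U (k + 1) (x + 1) (y + 1)) := by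
        ring
    _ = T (k + 2) (x + 1) (y + 1) * U (k + 1) (x + 2) (y + 1) * U (k + 2) x (y + 1) +
        U (k + 1) (x + 1) (y + 2) * (T (k + 2) (x + 1) (y + 1) * U (k + 2) (x + 1) y) := by
      rw [hR]; ring
    _ = U (k + 2) x (y + 1) * (T (k + 2) (x + 1) (y + 1) * U (k + 1) (x + 2) (y + 1) +
          T (k + 2) (x + 2) y * U (k + 1) (x + 1) (y + 2)) +
        U (k + 1) (x + 1) (y + 2) * T (k + 3) (x + 1) y * U (k + 1) (x + 1) (y + 1) := by
      rw [hO']; ring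
    _ = (T (k + 2) (x + 2) (y + 1) * U (k + 2) x (y + 1) +
          U (k + 1) (x + 1) (y + 2) * T (k + 3) (x + 1) y) * U (k + 1) (x + 1) (y + 1) := by
      rw [← hC]; ring

/-- On the wall `x = 0` the two-term identities `U_wall` and `wall` replace the three-term
recurrences. -/
theorem relB_succ_zero (h : Coupled T U) {k y : ℕ} (hC : RelC T U k 0 (y + 1)) :
    RelB T U (k + 1) 0 y := by
  refine mul_right_cancel₀ (h.U_ne_zero k 0 (y + 1)) ?_
  have hU := h.U_wall k y
  have hw := h.wall k y
  simp only [RelC, zero_add, add_assoc, Nat.reduceAdd] at hC ⊢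
  calc (U (k + 2) 0 (y + 2) * T (k + 2) 1 (y + 1) + U (k + 1) 1 (y + 2) * T (k + 3) 0 (y + 1)) *
        U (k + 1) 0 (y + 2)
      = (U (k + 2) 0 (y + 2) * U (k + 1) 0 (y + 2)) * T (k + 2) 1 (y + 1) +
        U (k + 1) 1 (y + 2) * (T (k + 3) 0 (y + 1) * U (k + 1) 0 (y + 2)) := by ring
    _ = U (k + 2) 0 (y + 1) * (T (k + 2) 0 (y + 2) * U (k + 1) 1 (y + 2) +
          T (k + 2) 1 (y + 1) * U (k + 1) 0 (y + 3)) := by rw [hU, hw]; ring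
    _ = T (k + 2) 1 (y + 2) * U (k + 2) 0 (y + 1) * U (k + 1) 0 (y + 2) := by rw [← hC]; ring

theorem relB_succ_succ (h : Coupled T U) {k x y : ℕ} (hA : RelA T U (k + 1) x y)
    (hB : RelB T U (k + 1) x y) (hC : RelC T U k (x + 1) (y + 1)) :
    RelB T U (k + 1) (x + 1) y := by
  -- Two factors are needed: the `U` factor expands the first summand by the recurrence for `U`, the
  -- `T` factor the second by that for `T`.
  refine mul_right_cancel₀ (mul_ne_zero (h.U_ne_zero k (x + 1) (y + 1))
    (h.T_ne_zero (k + 1) (x + 1) y)) ?_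
  have hT := h.T_rec (k + 1) x y
  have hU := h.U_rec k x (y + 1)
  simp only [RelA, RelB, RelC, add_assoc, Nat.reduceAdd] at hA hB hC hT hU ⊢
  calc (U (k + 2) (x + 1) (y + 2) * T (k + 2) (x + 2) (y + 1) +
          U (k + 1) (x + 2) (y + 2) * T (k + 3) (x + 1) (y + 1)) *
        (U (k + 1) (x + 1) (y + 2) * T (k + 2) (x + 1) (y + 1))
      = (U (k + 2) (x + 1) (y + 2) * U (k + 1) (x + 1) (y + 2)) * T (k + 2) (x + 2) (y + 1) *
          T (k + 2) (x + 1) (y + 1) +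
        (T (k + 3) (x + 1) (y + 1) * T (k + 2) (x + 1) (y + 1)) * U (k + 1) (x + 2) (y + 2) *
          U (k + 1) (x + 1) (y + 2) := by ring
    _ = U (k + 1) (x + 2) (y + 2) * T (k + 2) (x + 2) (y + 1) *
          (U (k + 2) x (y + 2) * T (k + 2) (x + 1) (y + 1) +
            U (k + 1) (x + 1) (y + 2) * T (k + 3) x (y + 1)) +
        U (k + 1) (x + 1) (y + 3) * U (k + 2) (x + 1) (y + 1) * T (k + 2) (x + 2) (y + 1) *
          T (k + 2) (x + 1) (y + 1) +
        T (k + 2) (x + 1) (y + 2) * T (k + 3) (x + 1) y * U (k + 1) (x + 2) (y + 2) *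
          U (k + 1) (x + 1) (y + 2) := by rw [hT, hU]; ring
    _ = U (k + 1) (x + 2) (y + 2) * T (k + 2) (x + 1) (y + 2) *
          (T (k + 2) (x + 2) (y + 1) * U (k + 2) x (y + 1) +
            U (k + 1) (x + 1) (y + 2) * T (k + 3) (x + 1) y) +
        U (k + 1) (x + 1) (y + 3) * U (k + 2) (x + 1) (y + 1) * T (k + 2) (x + 2) (y + 1) *
          T (k + 2) (x + 1) (y + 1) := by rw [hB]; ring
    _ = U (k + 2) (x + 1) (y + 1) * T (k + 2) (x + 1) (y + 1) *
        (T (k + 2) (x + 1) (y + 2) * U (k + 1) (x + 2) (y + 2) +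
          T (k + 2) (x + 2) (y + 1) * U (k + 1) (x + 1) (y + 3)) := by rw [← hA]; ring
    _ = T (k + 2) (x + 2) (y + 2) * U (k + 2) (x + 1) (y + 1) *
        (U (k + 1) (x + 1) (y + 2) * T (k + 2) (x + 1) (y + 1)) := by rw [← hC]; ring

/-- Only `RelC` is carried from layer to layer. Within a layer, the other two relations depend on
each other at points with smaller `x + y`. -/
theorem relA_relB_succ (h : Coupled T U) {k : ℕ} (hC : ∀ x y, RelC T U k x y) (m : ℕ) :
    ∀ x y, x + y = m → RelA T U (k + 1) x y ∧ RelB T U (k + 1) x y := by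
  induction m using Nat.strong_induction_on with
  | _ m ih =>
    rintro x y rfl
    refine ⟨h.relA_succ (hC _ _) ?_, ?_⟩
    · rintro z rfl
      obtain ⟨hA, hB⟩ := ih (x + z) (by omega) x z rfl
      exact h.relOct hA hB
    · cases x with
      | zero => exact h.relB_succ_zero (hC _ _)
      | succ x =>
        obtain ⟨hA, hB⟩ := ih (x + y) (by omega) x y rfl
        exact h.relB_succ_succ hA hB (hC _ _)

theorem rel_all (h : Coupled T U) (k : ℕ) :
    ∀ x y, RelA T U k x y ∧ RelB T U k x y ∧ RelC T U k x y := by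
  induction k with
  | zero => exact h.rel_zero
  | succ k ih =>
    intro x y
    obtain ⟨hA, hB⟩ := h.relA_relB_succ (fun x y => (ih x y).2.2) _ x y rfl
    exact ⟨hA, hB, h.relC_succ hA hB⟩

theorem relOct_all (h : Coupled T U) (k x y : ℕ) : RelOct T U k x y :=
  h.relOct (h.rel_all k x y).1 (h.rel_all k x y).2.1

end Coupled
/-! ### Bilinear relations for the evolution of a seed -/

section Evolution

/-- A zero-free semifield with a zero adjoined is a commutative semiring. -/
instance {F : Type*} [ZeroFreeSemifield F] : CommSemiring (WithZero F) where
  __ := (inferInstance : CommMonoidWithZero (WithZero F))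
  __ := (inferInstance : Distrib (WithZero F))
  add_assoc a b c := by
    induction a <;> induction b <;> induction c <;>
      simp only [zero_add, add_zero, ← WithZero.coe_add, add_assoc]
  zero_add := zero_add
  add_zero := add_zero
  add_comm a b := by
    induction a <;> induction b <;> simp only [zero_add, add_zero, ← WithZero.coe_add, add_comm]
  nsmul := nsmulRec

variable {F : Type*} [ZeroFreeSemifield F]

/-! ### Wall values and the normalized evolution -/

/-- The wall and corner rules contain no sum and involve wall values only, so the walls evolve
autonomously by monomials in the initial data. -/
theorem evolve_walls (s : ℕ → ℕ → F) (k : ℕ) :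
    (∀ x, evolve s k x 0 = s (x + k) 0 * s 0 k / s 0 0) ∧
      ∀ y, evolve s k 0 y = s 0 (y + k) * s k 0 / s 0 0 := by
  induction k with
  | zero => simp [evolve]
  | succ k ih =>
    obtain ⟨ihx, ihy⟩ := ih
    refine ⟨fun x => ?_, fun y => ?_⟩
    · induction x with
      | zero =>
        rw [evolve, ihx, ihx, ihy, zero_add, zero_add, add_comm 1 k]
        apply Additive.ofMul.injective
        simp only [ofMul_mul, ofMul_div]
        abel
      | succ x ihm =>
        rw [evolve, ihx, ihx, ihm, show x + 2 + k = x + 1 + (k + 1) by omega,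
          show x + (k + 1) = x + 1 + k by omega]
        apply Additive.ofMul.injective
        simp only [ofMul_mul, ofMul_div]
        abel
    · induction y with
      | zero =>
        rw [evolve, ihx, ihx, ihy, zero_add, zero_add, add_comm 1 k]
        apply Additive.ofMul.injective
        simp only [ofMul_mul, ofMul_div]
        abel
      | succ y ihm =>
        rw [evolve, ihy, ihy, ihm, show y + 2 + k = y + 1 + (k + 1) by omega,
          show y + (k + 1) = y + 1 + k by omega]
        apply Additive.ofMul.injective
        simp only [ofMul_mul, ofMul_div]
        abel

/-- The evolution of a seed, normalized by the value of the seed at the origin. -/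
def tau (s : ℕ → ℕ → F) (k x y : ℕ) : F := s 0 0 * evolve s k x y

theorem tau_zero (s : ℕ → ℕ → F) (x y : ℕ) : tau s 0 x y = s 0 0 * s x y := by
  rw [tau, evolve]

theorem tau_wall_y (s : ℕ → ℕ → F) (k x : ℕ) : tau s k x 0 = s (x + k) 0 * s 0 k := by
  rw [tau, (evolve_walls s k).1, mul_div_cancel]

theorem tau_wall_x (s : ℕ → ℕ → F) (k y : ℕ) : tau s k 0 y = s 0 (y + k) * s k 0 := by
  rw [tau, (evolve_walls s k).2, mul_div_cancel]

theorem tau_rec (s : ℕ → ℕ → F) (k x y : ℕ) :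
    tau s (k + 1) (x + 1) (y + 1) * tau s k (x + 1) (y + 1) =
      tau s k (x + 2) (y + 1) * tau s (k + 1) x (y + 1) +
        tau s k (x + 1) (y + 2) * tau s (k + 1) (x + 1) y := by
  simp only [tau]
  rw [mul_mul_mul_comm, evolve, div_mul_cancel, mul_add, mul_mul_mul_comm (s 0 0) (s 0 0) (evolve s k _ _),
    mul_mul_mul_comm (s 0 0) (s 0 0) (evolve s k _ _)]

theorem tau_rec_wall_y (s : ℕ → ℕ → F) (k x : ℕ) :
    tau s (k + 1) (x + 1) 0 * tau s k (x + 1) 0 = tau s k (x + 2) 0 * tau s (k + 1) x 0 := by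
  simp only [tau]
  rw [mul_mul_mul_comm, evolve, div_mul_cancel, mul_mul_mul_comm (s 0 0)]

theorem tau_rec_wall_x (s : ℕ → ℕ → F) (k y : ℕ) :
    tau s (k + 1) 0 (y + 1) * tau s k 0 (y + 1) = tau s k 0 (y + 2) * tau s (k + 1) 0 y := by
  simp only [tau]
  rw [mul_mul_mul_comm, evolve, div_mul_cancel, mul_mul_mul_comm (s 0 0)]

theorem tau_rec_corner (s : ℕ → ℕ → F) (k : ℕ) :
    tau s (k + 1) 0 0 * tau s k 0 0 = tau s k 1 0 * tau s k 0 1 := by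
  simp only [tau]
  rw [mul_mul_mul_comm, evolve, div_mul_cancel, mul_mul_mul_comm (s 0 0)]

/-- The array `tau`, with zeros added for `k = -1` and for `y = -1`; the indices `k` and `y` are
shifted by one. -/
def tauZero (s : ℕ → ℕ → F) : ℕ → ℕ → ℕ → WithZero F
  | k + 1, x, y + 1 => (tau s k x y : F)
  | _, _, _ => 0

/-- The added zeros turn the rule on the wall `y = 0` into an instance of the interior rule. -/
theorem tauZero_rec (s : ℕ → ℕ → F) (k x y : ℕ) :
    tauZero s (k + 2) (x + 1) (y + 1) * tauZero s (k + 1) (x + 1) (y + 1) =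
      tauZero s (k + 1) (x + 2) (y + 1) * tauZero s (k + 2) x (y + 1) +
        tauZero s (k + 1) (x + 1) (y + 2) * tauZero s (k + 2) (x + 1) y := by
  cases y with
  | zero =>
    simp only [tauZero, mul_zero, add_zero]
    exact_mod_cast tau_rec_wall_y s k x
  | succ y =>
    simp only [tauZero]
    exact_mod_cast tau_rec s k x y

theorem coupled_tauZero (s : ℕ → ℕ → F) :
    Coupled (tauZero s) (tauZero fun a b => s (a + 1) b) where
  T_zero_right k x := by cases k <;> rfl
  U_zero_right k x := by cases k <;> rfl
  U_zero_left x y := by cases y <;> rfl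
  T_ne_zero _ _ _ := WithZero.coe_ne_zero
  U_ne_zero _ _ _ := WithZero.coe_ne_zero
  T_rec := tauZero_rec s
  U_rec := tauZero_rec _
  U_wall k y := by
    simp only [tauZero]
    exact_mod_cast tau_rec_wall_x _ k (y)
  wall k y := by
    simp only [tauZero, ← WithZero.coe_mul, tau_wall_x, WithZero.coe_inj]
    rw [show y + 1 + (k + 1) = y + (k + 2) by omega, show y + 1 + k = y + (k + 1) by omega]
    apply Additive.ofMul.injective
    simp only [ofMul_mul]
    abel
  -- The initial values agree up to translation; the constant is the ratio of the normalizing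
  -- factors of the shifted and the original seed.
  layer := ⟨((s 1 0 / s 0 0 : F) : WithZero F), fun x y => by
    simp only [tauZero, ← WithZero.coe_mul, tau_zero, WithZero.coe_inj]
    rw [← mul_assoc, div_mul_cancel]⟩

/-! ### Octahedron relations between a seed and its shift -/

theorem tau_oct (s : ℕ → ℕ → F) (k x y : ℕ) :
    tau s (k + 1) (x + 1) (y + 1) * tau (fun a b => s (a + 1) b) (k + 1) (x + 1) y =
      tau s (k + 1) (x + 2) y * tau (fun a b => s (a + 1) b) (k + 1) x (y + 1) +
        tau s (k + 2) (x + 1) y * tau (fun a b => s (a + 1) b) k (x + 1) (y + 1) := by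
  have := (coupled_tauZero s).relOct_all (k + 1) x y
  simp only [Coupled.RelOct, tauZero] at this
  exact_mod_cast this

/-- This is the case of the same relation in which the added zero layer of `U` kills one summand. -/
theorem tau_oct_layer (s : ℕ → ℕ → F) (x y : ℕ) :
    tau s 0 (x + 1) (y + 1) * tau (fun a b => s (a + 1) b) 0 (x + 1) y =
      tau s 0 (x + 2) y * tau (fun a b => s (a + 1) b) 0 x (y + 1) := by
  have := (coupled_tauZero s).relOct_all 0 x y
  simp only [Coupled.RelOct, tauZero, mul_zero, add_zero] at this
  exact_mod_cast this

theorem tau_oct_wall (s : ℕ → ℕ → F) (k y : ℕ) :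
    tau s (k + 1) 0 (y + 1) * tau (fun a b => s (a + 1) b) (k + 1) 0 y =
      tau s (k + 2) 0 y * tau (fun a b => s (a + 1) b) k 0 (y + 1) := by
  simp only [tau_wall_x]
  rw [show y + 1 + (k + 1) = y + (k + 2) by omega, show y + 1 + k = y + (k + 1) by omega]
  apply Additive.ofMul.injective
  simp only [ofMul_mul]
  abel

theorem tau_oct_corner (s : ℕ → ℕ → F) (y : ℕ) :
    tau s 0 0 (y + 1) * tau (fun a b => s (a + 1) b) 0 0 y = tau s 1 0 y * tau s 0 1 y := by
  simp only [tau_wall_x, tau_zero, zero_add]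
  apply Additive.ofMul.injective
  simp only [ofMul_mul]
  abel_nf

/-- The evolutions of two seeds related by a rotation of the triangle of size `n` are related
by the inverse rotation. -/
theorem tau_rotate {n : ℕ} {s s' : ℕ → ℕ → F} (h : ∀ x y, x + y ≤ n → s' x y = s (n - x - y) x)
    (k x y g : ℕ) (hn : x + y + k + g = n) : tau s' k x y = tau (fun a b => s (a + g) b) x y k := by
  induction k generalizing x y g with
  | zero =>
    -- The initial layer on the left corresponds to the wall on the right, where the closed form
    -- applies; both sides equal `s n 0 * s (n - x - y) x`.
    rw [tau_zero, tau_wall_y, h 0 0 (by omega), h x y (by omega)]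
    congr 2 <;> omega
  | succ k ih =>
    have e (g : ℕ) : (fun a b => s (a + (g + 1)) b) = fun a b => s (a + 1 + g) b := by
      funext a b; congr 1; omega
    -- The recurrence refers to layer `k`, covered by the outer induction, and to points of layer `k
    -- + 1` with smaller `x + y`.
    induction hm : x + y using Nat.strong_induction_on generalizing x y g with
    | _ m ihm =>
      subst hm
      -- Lowering one coordinate at fixed `n` raises `g`; hence the recurrence on the left
      -- corresponds to a relation between consecutive shifts.
      have hd := ih x y (g + 1) (by omega)
      apply mul_right_cancel (b := tau s' k x y)
      rcases x with _ | x <;> rcases y with _ | y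
      · rw [tau_rec_corner, hd, e, ih 1 0 g (by omega), ih 0 1 g (by omega)]
        exact (tau_oct_corner (fun a b => s (a + g) b) k).symm
      · rw [tau_rec_wall_x, hd, e, ih 0 (y + 2) g (by omega),
          ihm (0 + y) (by omega) 0 y (g + 1) (by omega) rfl, e]
        exact (tau_oct_layer (fun a b => s (a + g) b) y k).symm
      · rw [tau_rec_wall_y, hd, e, ih (x + 2) 0 g (by omega),
          ihm (x + 0) (by omega) x 0 (g + 1) (by omega) rfl, e]
        exact (tau_oct_wall (fun a b => s (a + g) b) x k).symm
      · rw [tau_rec, hd, e, ih (x + 2) (y + 1) g (by omega), ih (x + 1) (y + 2) g (by omega),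
          ihm (x + (y + 1)) (by omega) x (y + 1) (g + 1) (by omega) rfl,
          ihm (x + 1 + y) (by omega) (x + 1) y (g + 1) (by omega) rfl, e, add_comm]
        exact (tau_oct (fun a b => s (a + g) b) x y k).symm

end Evolution

section Maps

variable {F : Type*} {n : ℕ}

/-! ### Time reversal -/

theorem neg_mem_latticePoints_quarter {x y t : ℤ}
    (h : (x, y, t) ∈ latticePoints n (quarterOctahedron n)) :
    (x, y, -t) ∈ latticePoints n (quarterOctahedron n) := by
  rw [mem_latticePoints_quarter] at h ⊢
  omega

/-- Time reversal of a state of the quarter-octahedron. -/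
def timeReversal (g : State F n (quarterOctahedron n)) : State F n (quarterOctahedron n) :=
  fun p => g ⟨(p.1.1, p.1.2.1, -p.1.2.2), neg_mem_latticePoints_quarter p.2⟩

theorem timeReversal_timeReversal (g : State F n (quarterOctahedron n)) :
    timeReversal (timeReversal g) = g := by
  funext p
  simp only [timeReversal, neg_neg]

theorem timeReversal_mk (g : State F n (quarterOctahedron n)) {x y t t' : ℤ}
    (h : (x, y, t) ∈ latticePoints n (quarterOctahedron n)) 
    (h' : (x, y, t') ∈ latticePoints n (quarterOctahedron n)) (ht : t' = -t) :
    timeReversal g ⟨(x, y, t), h⟩ = g ⟨(x, y, t'), h'⟩ := by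
  subst ht
  rfl

variable [ZeroFreeSemifield F]

/-! ### Compatibility with the rotations -/

theorem seed_apply (f : State F n (lowerTriangle n)) (p : latticePoints n (lowerTriangle n))
    (x y : ℕ) (h : p.1 = ((x : ℤ), (y : ℤ), (x : ℤ) + y - n)) : seed f x y = f p := by
  have hp := p.2
  rw [h] at hp
  rw [seed, dif_pos hp]
  exact congrArg f (Subtype.ext h.symm)

/-- Since `x + y + z = n` on `S'`, solving `z = x + y - n + 2 * k` gives `k = z`. -/
theorem phi_apply (f : State F n (lowerTriangle n)) (p : latticePoints n (upperTriangle n))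
    (x y z : ℕ) (h : p.1 = ((x : ℤ), (y : ℤ), (z : ℤ))) : phi f p = evolve (seed f) z x y := by
  have hp := p.2
  rw [h, mem_latticePoints_upper] at hp
  rw [phi, ← eq_extend (evolved_satisfies f) (restrict_evolved f)]
  refine evolved_apply f _ z x y ?_
  simp only [h, Prod.mk.injEq, true_and]
  omega

theorem seed_comp_r (f : State F n (lowerTriangle n)) (x y : ℕ) (h : x + y ≤ n) :
    seed (f ∘ r) x y = seed f (n - x - y) x := by
  have hp : ((x : ℤ), (y : ℤ), (x : ℤ) + y - n) ∈ latticePoints n (lowerTriangle n) := by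
    rw [mem_latticePoints_lower]; omega
  rw [seed_apply (f ∘ r) ⟨_, hp⟩ x y rfl, seed_apply f (r ⟨_, hp⟩) (n - x - y) x]
  · rfl
  · dsimp only [r]
    rw [Prod.mk.injEq, Prod.mk.injEq]
    omega

/-- This is `tau_rotate` with `g = 0`, the normalizations moved to one side. The scalar is the ratio
of the values of `f` at `(0, 0, -n)` and `(n, 0, 0)`. -/
theorem phi_comp_r (f : State F n (lowerTriangle n)) :
    phi (f ∘ r) = (seed f 0 0 / seed (f ∘ r) 0 0) • (phi f ∘ r') := by
  funext p
  obtain ⟨⟨x, y, z⟩, hp⟩ := p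
  have h := mem_latticePoints_upper.1 hp
  lift x to ℕ using h.1
  lift y to ℕ using h.2.1
  lift z to ℕ using by omega
  rw [Pi.smul_apply, Function.comp_apply, smul_eq_mul, phi_apply _ _ x y z rfl,
    phi_apply f (r' ⟨_, hp⟩) y z x rfl, div_mul_eq_mul_div, eq_div_iff_mul_eq', mul_comm]
  exact tau_rotate (seed_comp_r f) z x y 0 (by omega)

theorem pullback_comp_phiBar :
    pullback (F := F) (r' (n := n)) ∘ phiBar = phiBar ∘ pullback (F := F) (r (n := n)) := by
  funext q
  induction q using Quotient.inductionOn with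
  | h f =>
      have h : phi (f ∘ r) ∈ MulAction.orbit F (phi f ∘ r') := ⟨_, (phi_comp_r f).symm⟩
      exact (Quotient.sound h).symm

/-! ### Bijectivity -/

/-- Each rule is symmetric in its values at `t + 1` and `t - 1`: solving it for either one gives the
same form. -/
theorem SatisfiesRecurrence.timeReversal {g : State F n (quarterOctahedron n)}
    (hg : SatisfiesRecurrence g) : SatisfiesRecurrence (timeReversal g) := by
  have hu' {x y t : ℤ} (h : (x, y, t - 1) ∈ latticePoints n (quarterOctahedron n)) :
      (x, y, -t + 1) ∈ latticePoints n (quarterOctahedron n) := by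
    simpa [neg_add_eq_sub] using neg_mem_latticePoints_quarter h
  have hd' {x y t : ℤ} (h : (x, y, t + 1) ∈ latticePoints n (quarterOctahedron n)) :
      (x, y, -t - 1) ∈ latticePoints n (quarterOctahedron n) := by
    simpa [sub_eq_add_neg, add_comm] using neg_mem_latticePoints_quarter h
  refine ⟨?_, ?_, ?_, ?_⟩
  · intro x y t hx hy hu hd he hw hn hs
    rw [timeReversal_mk g hu (hd' hu) (by ring), timeReversal_mk g hd (hu' hd) (by ring),
      hg.interior x y (-t) hx hy (hu' hd) (hd' hu) (neg_mem_latticePoints_quarter he)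
        (neg_mem_latticePoints_quarter hw) (neg_mem_latticePoints_quarter hn)
        (neg_mem_latticePoints_quarter hs)]
    exact (div_div_cancel _ _).symm
  · intro x t hx hu hd he hw
    rw [timeReversal_mk g hu (hd' hu) (by ring), timeReversal_mk g hd (hu' hd) (by ring),
      hg.wall_y x (-t) hx (hu' hd) (hd' hu) (neg_mem_latticePoints_quarter he)
        (neg_mem_latticePoints_quarter hw)]
    exact (div_div_cancel _ _).symm
  · intro y t hy hu hd hn hs
    rw [timeReversal_mk g hu (hd' hu) (by ring), timeReversal_mk g hd (hu' hd) (by ring),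
      hg.wall_x y (-t) hy (hu' hd) (hd' hu) (neg_mem_latticePoints_quarter hn)
        (neg_mem_latticePoints_quarter hs)]
    exact (div_div_cancel _ _).symm
  · intro t hu hd he hn
    rw [timeReversal_mk g hu (hd' hu) (by ring), timeReversal_mk g hd (hu' hd) (by ring),
      hg.corner (-t) (hu' hd) (hd' hu) (neg_mem_latticePoints_quarter he)
        (neg_mem_latticePoints_quarter hn)]
    exact (div_div_cancel _ _).symm

theorem neg_mem_upper {x y t : ℤ} (h : (x, y, t) ∈ latticePoints n (lowerTriangle n)) :
    (x, y, -t) ∈ latticePoints n (upperTriangle n) := by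
  rw [mem_latticePoints_lower] at h
  rw [mem_latticePoints_upper]
  omega

theorem neg_mem_lower {x y t : ℤ} (h : (x, y, t) ∈ latticePoints n (upperTriangle n)) :
    (x, y, -t) ∈ latticePoints n (lowerTriangle n) := by
  rw [mem_latticePoints_upper] at h
  rw [mem_latticePoints_lower]
  omega

/-- The reversed extension has as initial data the reflection of `phi f`, so uniqueness of
extensions recovers it, and with it `f`. -/
theorem phi_injective : Function.Injective (phi (F := F) (n := n)) := by
  intro f₁ f₂ h
  have key : timeReversal (extend f₁) = timeReversal (extend f₂) := by
    rw [eq_extend (extend_spec f₁).1.timeReversal rfl, eq_extend (extend_spec f₂).1.timeReversal rfl]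
    congr 1
    funext p
    exact congrFun h ⟨_, neg_mem_upper p.2⟩
  rw [← (extend_spec f₁).2, ← (extend_spec f₂).2, ← timeReversal_timeReversal (extend f₁), key,
    timeReversal_timeReversal]

theorem phi_surjective : Function.Surjective (phi (F := F) (n := n)) := by
  intro h
  let f : State F n (lowerTriangle n) := fun p => h ⟨_, neg_mem_upper p.2⟩
  -- The preimage is found by evolving the reflected target and reversing time.
  refine ⟨restrict (lower_subset n) (timeReversal (extend f)), ?_⟩
  rw [phi, ← eq_extend (extend_spec f).1.timeReversal rfl]
  funext p
  have := congrFun (extend_spec f).2 ⟨_, neg_mem_lower p.2⟩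
  refine this.trans ?_
  simp only [f, neg_neg]

theorem phiBar_bijective : Function.Bijective (phiBar (F := F) (n := n)) := by
  constructor
  · intro p q
    induction p, q using Quotient.inductionOn₂ with
    | h f g =>
      intro h
      obtain ⟨c, hc⟩ := Quotient.exact h
      refine Quotient.sound ⟨c, phi_injective ?_⟩
      exact (phi_smul c g).trans hc
  · intro q
    induction q using Quotient.inductionOn with
    | h g =>
      obtain ⟨f, rfl⟩ := phi_surjective g
      exact ⟨projClass f, rfl⟩

end Maps

end Octahedron

theorem mainTheorem3 {F : Type*} [Octahedron.ZeroFreeSemifield F] (n : ℕ) :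
    Function.Bijective (Octahedron.phi (F := F) (n := n)) ∧
    Function.Bijective (Octahedron.phiBar (F := F) (n := n)) ∧
    Octahedron.pullback (F := F) (Octahedron.r' (n := n)) ∘ Octahedron.phiBar =
      Octahedron.phiBar ∘ Octahedron.pullback (F := F) (Octahedron.r (n := n)) :=
  ⟨⟨Octahedron.phi_injective, Octahedron.phi_surjective⟩, Octahedron.phiBar_bijective,
    Octahedron.pullback_comp_phiBar⟩
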